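/- \textbf{The MIS algorithm.} Let $G=(V,E)$ be a finite simple graph. Every node is initially active and holds a variable $p_v$, initially $1/2$. In each phase, every active node $v$ beeps with probability $p_v$, all choices being independent of each other and of the past; inactive nodes do not beep. An active node that beeps while none of its neighbours beeps enters the independent set and becomes inactive, and all its neighbours that are still active become inactive too (outside the independent set). Then $p_v$ is replaced by $p_v/2$ if some neighbour of $v$ beeped in this phase, and by $\min(2p_v,1/2)$ otherwise. Thus $p_v\in\{2^{-k}:k\ge 1\}$ at all times. \textbf{Theorem.} Consider any configuration of this algorithm between two phases, i.e. any assignment to the nodes of a status (active, in the independent set, or eliminated) and of a value $p_v\in\{2^{-k}:k\ge1\}$; in particular, the initial configuration or any configuration reached after some phases. For a node $v$ let $q_v=\sum_u p_u$, the sum being over the active neighbours $u$ of $v$, and let $$t_0=3\max\{\log_2(5q_v),0\}-2\log_2 p_v\qquad(\text{with }\max\{\log_2 0,0\}=0).$$ Then for every node $v$ and every integer $t\ge 0$, the probability that, starting from this configuration, $v$ is still active after the next $t$ phases is at most $\alpha^{t_0-t}$, where $\alpha=2^{1/36}$. -/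

import Mathlib

open scoped NNReal ENNReal

namespace BeepMIS

/-- Status of a node: still contending, in the independent set, or terminated outside it. -/
inductive Status where
  | active
  | inMIS
  | eliminated

/-- A configuration of the algorithm between two phases: the status of each node and the current
value of its beeping-probability variable `p`. Since `p` starts at `1/2` and is only halved, or
doubled with upper bound `1/2`, its values are `1/2, 1/4, 1/8, …`. -/
structure Config (V : Type*) where
  status : V → Status
  p : V → ℝ≥0
  p_dyadic : ∀ v, ∃ k : ℕ, p v = (1 / 2) ^ (k + 1)

namespace Config

/-- The configuration in which the algorithm starts. -/
noncomputable def initial (V : Type*) : Config V where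
  status := fun _ => Status.active
  p := fun _ => 1 / 2
  p_dyadic := fun _ => ⟨0, by simp⟩

variable {V : Type*}

/-- Node `v` still takes part in the computation. -/
def IsActive (C : Config V) (v : V) : Prop := C.status v = Status.active

open Classical in
/-- Probability that `v` beeps in the contention slot of the next phase: `p v` if `v` is active;
terminated nodes are silent. -/
noncomputable def beepProb (C : Config V) (v : V) : ℝ≥0 := if C.IsActive v then C.p v else 0

theorem p_le_half (C : Config V) (v : V) : C.p v ≤ 1 / 2 := by
  obtain ⟨k, hk⟩ := C.p_dyadic v
  rw [hk, pow_succ]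
  exact mul_le_of_le_one_left (by positivity)
    (pow_le_one₀ (by positivity) (by rw [← NNReal.coe_le_coe]; norm_num))

theorem beepProb_le_one (C : Config V) (v : V) : C.beepProb v ≤ 1 := by
  unfold beepProb
  split_ifs
  · exact (C.p_le_half v).trans (by rw [← NNReal.coe_le_coe]; norm_num)
  · exact zero_le_one

section Phase

/-- When `B` is the set of nodes that beep in the contention slot, `v` hears a beep (listening, or
by collision detection while beeping) iff one of its neighbours beeps. -/
def Hears (G : SimpleGraph V) (B : Finset V) (v : V) : Prop := ∃ u ∈ B, G.Adj v u

/-- `v` beeps exclusively: it beeps and none of its neighbours does. -/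
def BeepsExclusively (G : SimpleGraph V) (B : Finset V) (v : V) : Prop :=
  v ∈ B ∧ ¬ Hears G B v

open Classical in
/-- The new status. An active node that beeps exclusively enters the independent set and signals
this in the confirmation slot, upon which its active neighbours are eliminated. -/
noncomputable def nextStatus (G : SimpleGraph V) (C : Config V) (B : Finset V) (v : V) : Status :=
  if C.IsActive v then
    if BeepsExclusively G B v then Status.inMIS
    else if ∃ u, G.Adj v u ∧ BeepsExclusively G B u then Status.eliminated
    else Status.active
  else C.status v

open Classical in
/-- The new beeping probability: halved if a neighbour beeped, otherwise doubled up to `1/2`. -/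
noncomputable def nextP (G : SimpleGraph V) (C : Config V) (B : Finset V) (v : V) : ℝ≥0 :=
  if Hears G B v then C.p v / 2 else min (2 * C.p v) (1 / 2)

theorem nextP_dyadic (G : SimpleGraph V) (C : Config V) (B : Finset V) (v : V) :
    ∃ k : ℕ, C.nextP G B v = (1 / 2) ^ (k + 1) := by
  obtain ⟨k, hk⟩ := C.p_dyadic v
  unfold nextP
  split_ifs
  · exact ⟨k + 1, by rw [hk, pow_succ _ (k + 1), div_eq_mul_one_div]⟩
  · cases k with
    | zero =>
      refine ⟨0, ?_⟩
      rw [hk, min_eq_right]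
      · simp
      · rw [← NNReal.coe_le_coe]; norm_num
    | succ j =>
      refine ⟨j, ?_⟩
      have h2 : 2 * C.p v = (1 / 2) ^ (j + 1) := by
        rw [hk, pow_succ _ (j + 1), mul_comm, mul_assoc]
        norm_num
      rw [h2, min_eq_left]
      rw [pow_succ]
      exact mul_le_of_le_one_left (by positivity)
        (pow_le_one₀ (by positivity) (by rw [← NNReal.coe_le_coe]; norm_num))

/-- The configuration after one phase whose contention slot has beeping set `B`. -/
noncomputable def next (G : SimpleGraph V) (C : Config V) (B : Finset V) : Config V where
  status := C.nextStatus G B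
  p := C.nextP G B
  p_dyadic := C.nextP_dyadic G B

end Phase

variable [Fintype V]

open Classical in
theorem sum_beepWeight (C : Config V) :
    ∑ B : Finset V, ∏ v, (if v ∈ B then (C.beepProb v : ℝ≥0∞) else 1 - C.beepProb v) = 1 := by
  have h := Finset.prod_add (fun v => (C.beepProb v : ℝ≥0∞)) (fun v => 1 - (C.beepProb v : ℝ≥0∞))
    (Finset.univ : Finset V)
  have h1 : ∀ v, (C.beepProb v : ℝ≥0∞) + (1 - C.beepProb v) = 1 := fun v =>
    add_tsub_cancel_of_le (by exact_mod_cast C.beepProb_le_one v)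
  simp only [h1, Finset.prod_const_one, Finset.powerset_univ] at h
  refine Eq.trans ?_ h.symm
  refine Finset.sum_congr rfl fun B _ => ?_
  rw [Finset.prod_ite]
  congr 1
  · exact Finset.prod_congr (by ext; simp) fun _ _ => rfl
  · exact Finset.prod_congr (by ext; simp) fun _ _ => rfl

open Classical in
/-- Law of the set of nodes beeping in the contention slot: every node `v` beeps with probability
`beepProb v`, independently of the others. -/
noncomputable def beepLaw (C : Config V) : PMF (Finset V) :=
  PMF.ofFintype
    (fun B => ∏ v, (if v ∈ B then (C.beepProb v : ℝ≥0∞) else 1 - C.beepProb v))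
    C.sum_beepWeight

/-- Law of the configuration after one phase. -/
noncomputable def phase (G : SimpleGraph V) (C : Config V) : PMF (Config V) :=
  C.beepLaw.map (C.next G)

/-- Law of the configuration after `t` phases started from `C`; the random choices of each phase
are fresh. -/
noncomputable def run (G : SimpleGraph V) : ℕ → Config V → PMF (Config V)
  | 0, C => PMF.pure C
  | t + 1, C => (C.phase G).bind (run G t)

/-- Probability that `v` is still active after the next `t` phases, when the current configuration
is `C`. -/
noncomputable def probActive (G : SimpleGraph V) (C : Config V) (v : V) (t : ℕ) : ℝ≥0∞ :=
  (run G t C).toOuterMeasure {D | D.IsActive v}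

open Classical in
/-- `q v`, the sum of the beeping probabilities of the neighbours of `v`. -/
noncomputable def q (G : SimpleGraph V) (C : Config V) (v : V) : ℝ≥0 :=
  ∑ u with G.Adj v u, C.beepProb u

end Config

/-- `l x = log₂ (5 max {x, 1/5}) = max {log₂ (5 x), 0}`. -/
noncomputable def l (x : ℝ) : ℝ := Real.logb 2 (5 * max x (1 / 5))

/-- `t₀ = 3 l(q) - 2 log₂ p`, for the current values of `p` and `q` at `v`. -/
noncomputable def t₀ {V : Type*} [Fintype V] (G : SimpleGraph V) (C : Config V) (v : V) : ℝ :=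
  3 * l (C.q G v) - 2 * Real.logb 2 (C.p v)

/-- The constant `α = 2 ^ (1/36)`. -/
noncomputable def α : ℝ := (2 : ℝ) ^ ((1 : ℝ) / 36)

end BeepMIS

/-! The potential α^t₀, set to 0 once `v` is inactive, shrinks in expectation by a factor α per
phase. It is at least 1 while `v` is active, so iterating bounds the survival probability. It
factors as load(q) · boost(p). Hearing a beep multiplies boost by α²; silence multiplies it by α⁻²
or, if p = 1/2, lets `v` join the set with probability 1/2. When q is large, the neighbours that
hear something halve their p, and halving q gains α⁻³, which outweighs α². The danger is growth of q
through neighbours that hear nothing, of total weight Y. But such neighbours also tend to beep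
exclusively, which eliminates `v`: `exclusive_bound` gives P(v hears) · E[Y] ≤ q · P(a neighbour
beeps exclusively). Since `exists_load_bound` bounds the next load linearly in Y, the expected
growth is paid for by elimination. -/

namespace BeepMIS

/-! ### Independent random sets and exclusive beeps among neighbours. -/

section RandomSet

open Classical in
/-- Probability of the outcome `B` when every `v` is put into `B` independently with
probability `b v`. -/
noncomputable def weight {V : Type*} [Fintype V] (b : V → ℝ) (B : Finset V) : ℝ :=
  ∏ v, if v ∈ B then b v else 1 - b v

open Classical in
/-- Probability of the event `E` under the product law `weight b`. -/
noncomputable def prob {V : Type*} [Fintype V] (b : V → ℝ) (E : Finset V → Prop) : ℝ :=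
  ∑ B, if E B then weight b B else 0

/-- Probability that the random set avoids `T`. -/
noncomputable def silent {V : Type*} (b : V → ℝ) (T : Finset V) : ℝ := ∏ v ∈ T, (1 - b v)

variable {V : Type*} {b : V → ℝ}

theorem silent_nonneg (hb : ∀ v, b v ≤ 1) (T : Finset V) : 0 ≤ silent b T :=
  Finset.prod_nonneg fun v _ => sub_nonneg.2 (hb v)

theorem silent_le_one (h0 : ∀ v, 0 ≤ b v) (hb : ∀ v, b v ≤ 1) (T : Finset V) : silent b T ≤ 1 :=
  Finset.prod_le_one (fun v _ => sub_nonneg.2 (hb v)) fun v _ => by linarith [h0 v]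

open Classical in
theorem silent_insert {a : V} {T : Finset V} (ha : a ∉ T) :
    silent b (insert a T) = (1 - b a) * silent b T := Finset.prod_insert ha

-- Avoiding S and avoiding T are positively correlated, since the nodes of S ∩ T enter the left side
-- twice.
open Classical in
theorem silent_mul_le_union (h0 : ∀ v, 0 ≤ b v) (hb : ∀ v, b v ≤ 1) (S T : Finset V) :
    silent b S * silent b T ≤ silent b (S ∪ T) := by
  have h : silent b (S ∪ T) * silent b (S ∩ T) = silent b S * silent b T :=
    Finset.prod_union_inter
  rw [← h]
  exact mul_le_of_le_one_right (silent_nonneg hb _) (silent_le_one h0 hb _)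

theorem one_sub_sum_le_silent (h0 : ∀ v, 0 ≤ b v) (hb : ∀ v, b v ≤ 1) (T : Finset V) :
    1 - ∑ v ∈ T, b v ≤ silent b T := by
  classical
  induction T using Finset.induction_on with
  | empty => simp [silent]
  | insert a T ha ih =>
    rw [silent_insert ha, Finset.sum_insert ha]
    nlinarith [h0 a, silent_le_one h0 hb T]

theorem silent_mul_le_one (h0 : ∀ v, 0 ≤ b v) (hb : ∀ v, b v ≤ 1) (T : Finset V) :
    silent b T * (1 + ∑ v ∈ T, b v) ≤ 1 := by
  classical
  induction T using Finset.induction_on with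
  | empty => simp [silent]
  | insert a T ha ih =>
    rw [silent_insert ha, Finset.sum_insert ha]
    have hs := Finset.sum_nonneg fun v (_ : v ∈ T) => h0 v
    have h1 := mul_nonneg (silent_nonneg hb T) hs
    have h2 := mul_nonneg (silent_nonneg hb T) (h0 a)
    have h3 := mul_nonneg h1 (h0 a)
    have h4 := mul_nonneg h2 (h0 a)
    nlinarith

variable [Fintype V]

theorem weight_nonneg (h0 : ∀ v, 0 ≤ b v) (hb : ∀ v, b v ≤ 1) (B : Finset V) :
    0 ≤ weight b B := by
  refine Finset.prod_nonneg fun v _ => ?_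
  split_ifs
  · exact h0 v
  · exact sub_nonneg.2 (hb v)

theorem prob_mono (h0 : ∀ v, 0 ≤ b v) (hb : ∀ v, b v ≤ 1) {E F : Finset V → Prop}
    (h : ∀ B, E B → F B) : prob b E ≤ prob b F := by
  refine Finset.sum_le_sum fun B _ => ?_
  by_cases hE : E B
  · simp [hE, h B hE]
  · rw [if_neg hE]
    split_ifs
    · exact weight_nonneg h0 hb B
    · exact le_rfl

theorem prob_add {E F H : Finset V → Prop} (h : ∀ B, H B ↔ E B ∨ F B)
    (hd : ∀ B, E B → ¬ F B) : prob b H = prob b E + prob b F := by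
  unfold prob
  rw [← Finset.sum_add_distrib]
  refine Finset.sum_congr rfl fun B _ => ?_
  by_cases hE : E B
  · simp [h, hE, hd B hE]
  · have hB : H B ↔ F B := by rw [h]; tauto
    by_cases hF : F B <;> simp [hE, hB, hF]

theorem prob_disjoint (b : V → ℝ) (T : Finset V) : prob b (fun B => Disjoint T B) = silent b T := by
  classical
  -- With `b` replaced by 0 on `T`, expanding the product leaves exactly the sets that avoid `T`.
  have h := Finset.prod_add (fun v => if v ∈ T then 0 else b v) (fun v => 1 - b v)
    (Finset.univ : Finset V)
  have h1 : ∀ v, (if v ∈ T then 0 else b v) + (1 - b v) = if v ∈ T then 1 - b v else 1 := by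
    intro v; split_ifs <;> ring
  simp only [h1, Finset.powerset_univ] at h
  rw [Finset.prod_ite_mem, Finset.univ_inter] at h
  rw [silent, h, prob]
  refine Finset.sum_congr rfl fun B _ => ?_
  split_ifs with hd
  · rw [weight, Finset.prod_ite]
    congr 1
    · refine Finset.prod_congr (by ext; simp) fun v hv => ?_
      rw [if_neg (Finset.disjoint_right.1 hd hv)]
    · exact Finset.prod_congr (by ext; simp) fun _ _ => rfl
  · obtain ⟨v, hT, hB⟩ := Finset.not_disjoint_iff.1 hd
    have h2 : ∏ v ∈ B, (if v ∈ T then 0 else b v) = 0 := Finset.prod_eq_zero hB (if_pos hT)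
    rw [h2, zero_mul]

theorem sum_weight (b : V → ℝ) : ∑ B, weight b B = 1 := by
  simpa [prob, silent] using prob_disjoint b ∅

theorem prob_mem_disjoint {a : V} {T : Finset V} (ha : a ∉ T) :
    prob b (fun B => a ∈ B ∧ Disjoint T B) = b a * silent b T := by
  classical
  have h := prob_add (b := b) (H := fun B => Disjoint T B) (E := fun B => a ∈ B ∧ Disjoint T B)
    (F := fun B => Disjoint (insert a T) B)
    (fun B => by rw [Finset.disjoint_insert_left]; tauto)
    (fun B h1 h2 => by rw [Finset.disjoint_insert_left] at h2; exact h2.1 h1.1)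
  rw [prob_disjoint, prob_disjoint, silent_insert ha] at h
  linarith

open Classical in
/-- The neighbours of `v` as a finite set. -/
noncomputable def nbrs (G : SimpleGraph V) (v : V) : Finset V := {u | G.Adj v u}

variable (G : SimpleGraph V)

theorem mem_nbrs {u v : V} : u ∈ nbrs G v ↔ G.Adj v u := by simp [nbrs]

theorem not_hears_iff {B : Finset V} {v : V} :
    ¬ Config.Hears G B v ↔ Disjoint (nbrs G v) B := by
  rw [Finset.disjoint_left, Config.Hears]
  simp only [mem_nbrs]
  exact ⟨fun h u hu hB => h ⟨u, hB, hu⟩, fun h ⟨u, hB, hu⟩ => h hu hB⟩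

/-- Scanning `A` by decreasing probability of hearing nothing, the first beeping node is exclusive
with a probability `S` that satisfies Chebyshev's sum inequality. -/
theorem exists_scan_bound (h0 : ∀ v, 0 ≤ b v) (hb : ∀ v, b v ≤ 1) (A : Finset V) :
    ∃ S : ℝ,
      (∀ T, Disjoint T A → silent b T * S ≤
        prob b (fun B => Disjoint T B ∧ ∃ u ∈ A, Config.BeepsExclusively G B u)) ∧
      (1 - silent b A) * ∑ u ∈ A, b u * silent b (nbrs G u) ≤ (∑ u ∈ A, b u) * S ∧
      ∀ n, (∀ u ∈ A, silent b (nbrs G u) ≤ n) →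
        n * (1 - silent b A) - S ≤
          (∑ u ∈ A, b u) * n - ∑ u ∈ A, b u * silent b (nbrs G u) := by
  classical
  induction A using Finset.induction_on_max_value (fun u => silent b (nbrs G u)) with
  | empty =>
    refine ⟨0, fun T _ => ?_, by simp [silent], fun n _ => by simp [silent]⟩
    simp [prob]
  | insert a A ha hmax ih =>
    obtain ⟨S, h1, h2, h3⟩ := ih
    have hbound : ∀ n, (∀ u ∈ A, silent b (nbrs G u) ≤ n) →
        ∑ u ∈ A, b u * silent b (nbrs G u) ≤ (∑ u ∈ A, b u) * n := fun n hn => by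
      rw [Finset.sum_mul]
      exact Finset.sum_le_sum fun u hu => mul_le_mul_of_nonneg_left (hn u hu) (h0 u)
    -- The maximiser `a` is scanned first; if it is silent, the scan continues in `A`. Thus S = Σ
    -- w_u n_u, where n_u is the silence probability around u and w_u the probability that u is the
    -- first to beep. Here w_u is b_u times a factor decreasing along the scan, as n_u does: hence
    -- Chebyshev. The third claim, Σ w_u (n - n_u) ≤ Σ b_u (n - n_u), serves the induction for the
    -- second.
    refine ⟨b a * silent b (nbrs G a) + (1 - b a) * S, fun T hT => ?_, ?_, fun n hn => ?_⟩
    -- `T` collects the nodes already known to be silent; by positive correlation this knowledge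
    -- only helps exclusivity.
    · rw [Finset.disjoint_insert_right] at hT
      have hna : a ∉ T ∪ nbrs G a := by simp [hT.1, mem_nbrs]
      have e1 := prob_mem_disjoint (b := b) hna
      have e2 := h1 (insert a T) (Finset.disjoint_insert_left.2 ⟨ha, hT.2⟩)
      rw [silent_insert hT.1] at e2
      have e3 := mul_le_mul_of_nonneg_left (silent_mul_le_union h0 hb T (nbrs G a)) (h0 a)
      have e4 : prob b (fun B => (a ∈ B ∧ Disjoint (T ∪ nbrs G a) B) ∨
          (Disjoint (insert a T) B ∧ ∃ u ∈ A, Config.BeepsExclusively G B u)) =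
          prob b (fun B => a ∈ B ∧ Disjoint (T ∪ nbrs G a) B) +
          prob b (fun B => Disjoint (insert a T) B ∧
            ∃ u ∈ A, Config.BeepsExclusively G B u) :=
        prob_add (fun _ => Iff.rfl) fun B hB hB' =>
          (Finset.disjoint_insert_left.1 hB'.1).1 hB.1
      have e5 := prob_mono h0 hb (E := fun B => (a ∈ B ∧ Disjoint (T ∪ nbrs G a) B) ∨
          (Disjoint (insert a T) B ∧ ∃ u ∈ A, Config.BeepsExclusively G B u))
          (F := fun B => Disjoint T B ∧ ∃ u ∈ insert a A, Config.BeepsExclusively G B u) (by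
        rintro B (⟨hB, hd⟩ | ⟨hd, u, hu, hex⟩)
        · rw [Finset.disjoint_union_left] at hd
          exact ⟨hd.1, a, Finset.mem_insert_self _ _, hB, (not_hears_iff G).2 hd.2⟩
        · exact ⟨(Finset.disjoint_insert_left.1 hd).2, u, Finset.mem_insert_of_mem hu, hex⟩)
      nlinarith
    · rw [silent_insert ha, Finset.sum_insert ha, Finset.sum_insert ha]
      have h4 := h3 _ hmax
      have h5 := hbound _ hmax
      have h6 := mul_le_mul_of_nonneg_left h2 (sub_nonneg.2 (hb a))
      have h7 := mul_le_mul_of_nonneg_left h4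
        (mul_nonneg (h0 a) (sub_nonneg.2 (hb a)))
      have h8 := mul_le_mul_of_nonneg_left h5 (mul_nonneg (h0 a) (h0 a))
      nlinarith
    · rw [silent_insert ha, Finset.sum_insert ha, Finset.sum_insert ha]
      have hn' : ∀ u ∈ A, silent b (nbrs G u) ≤ n := fun u hu =>
        hn u (Finset.mem_insert_of_mem hu)
      have h6 := mul_le_mul_of_nonneg_left (h3 n hn') (sub_nonneg.2 (hb a))
      have h7 := mul_le_mul_of_nonneg_left (hbound n hn') (h0 a)
      nlinarith

theorem exclusive_bound (h0 : ∀ v, 0 ≤ b v) (hb : ∀ v, b v ≤ 1) (v : V) :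
    (1 - silent b (nbrs G v)) * ∑ u ∈ nbrs G v, b u * silent b (nbrs G u) ≤
      (∑ u ∈ nbrs G v, b u) *
        prob b (fun B => ∃ u, G.Adj v u ∧ Config.BeepsExclusively G B u) := by
  obtain ⟨S, h1, h2, -⟩ := exists_scan_bound G h0 hb (nbrs G v)
  have h := h1 ∅ (Finset.disjoint_empty_left _)
  simp only [silent, Finset.prod_empty, one_mul, Finset.disjoint_empty_left, true_and,
    mem_nbrs] at h
  exact h2.trans (mul_le_mul_of_nonneg_left h (Finset.sum_nonneg fun u _ => h0 u))

end RandomSet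

/-! ### Numerical estimates for the load. -/

section Growth

theorem α_pos : 0 < α := Real.rpow_pos_of_pos two_pos _

theorem α_pow : α ^ 36 = 2 := by
  rw [α, ← Real.rpow_natCast, ← Real.rpow_mul two_pos.le]
  norm_num

theorem lt_α : 1.019 < α := by
  refine lt_of_pow_lt_pow_left₀ 36 α_pos.le ?_
  rw [α_pow]; norm_num

theorem α_lt : α < 1.0196 := by
  refine lt_of_pow_lt_pow_left₀ 36 (by norm_num) ?_
  rw [α_pow]; norm_num

theorem α_pow_four : α ^ 4 < 1.081 :=
  (pow_lt_pow_left₀ α_lt α_pos.le (by norm_num)).trans (by norm_num)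

theorem α_rpow_three_logb {y : ℝ} (hy : 0 < y) :
    α ^ (3 * Real.logb 2 y) = y ^ ((1 : ℝ) / 12) := by
  rw [α, ← Real.rpow_mul two_pos.le]
  nth_rewrite 2 [← Real.rpow_logb two_pos (by norm_num) hy]
  rw [← Real.rpow_mul two_pos.le]
  congr 1; ring

/-- The contribution `α ^ (3 l x)` of `q = x` to `α ^ t₀`. -/
noncomputable def load (x : ℝ) : ℝ := max (5 * x) 1 ^ ((1 : ℝ) / 12)

theorem α_rpow_l (x : ℝ) : α ^ (3 * l x) = load x := by
  have h : 5 * max x (1 / 5) = max (5 * x) 1 := by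
    rw [mul_max_of_nonneg _ _ (by norm_num : (0 : ℝ) ≤ 5)]; norm_num
  rw [l, h, α_rpow_three_logb (lt_max_of_lt_right one_pos), load]

theorem rpow_twelfth_le {s : ℝ} (hs : -1 ≤ s) : (1 + s) ^ ((1 : ℝ) / 12) ≤ 1 + 1 / 12 * s :=
  rpow_one_add_le_one_add_mul_self hs (by norm_num) (by norm_num)

theorem halving_rate_le {h : ℝ} (h1 : h ≤ 1) : α ^ 2 * h + (α ^ 2)⁻¹ * (1 - h) ≤ α ^ 2 := by
  have h2 : 1 ≤ α ^ 2 := one_le_pow₀ (by linarith [lt_α])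
  nlinarith [inv_le_one_of_one_le₀ h2]

theorem final_bound_small {q h : ℝ} (hq : q ≤ 2 / 5) (hhq : h ≤ q) :
    α ^ 2 * h + (α ^ 2)⁻¹ * (1 - h) ≤ α⁻¹ * load q := by
  have ha := α_pos
  have h4 := α_pow_four
  have h4' : 1 ≤ α ^ 4 := one_le_pow₀ (by linarith [lt_α])
  have key : 1 + (α ^ 4 - 1) * h ≤ α * load q := by
    rcases le_total q (1 / 5) with hq5 | hq5
    · have hg : load q = 1 := by rw [load, max_eq_right (by linarith), Real.one_rpow]
      rw [hg]
      nlinarith [lt_α]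
    · have hq0 : 0 < q := by linarith
      have hg : load q = (5 * q) ^ ((1 : ℝ) / 12) := by rw [load, max_eq_left (by linarith)]
      have hy : 0 < (5 * q) ^ ((1 : ℝ) / 12) := Real.rpow_pos_of_pos (by linarith) _
      -- Bernoulli applied to the inverse gives a lower bound for the load: 1/load ≤ (55q +
      -- 1)/(60q).
      have hb := rpow_twelfth_le (s := (5 * q)⁻¹ - 1)
        (by linarith [inv_pos.2 (by linarith : 0 < 5 * q)])
      rw [add_sub_cancel, Real.inv_rpow (by linarith)] at hb
      have h1 : 60 * q ≤ (55 * q + 1) * load q := by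
        rw [hg]
        have h2 := mul_le_mul_of_nonneg_right hb (mul_pos hy (by linarith : 0 < 60 * q)).le
        have h3 : ((5 * q) ^ ((1 : ℝ) / 12))⁻¹ * ((5 * q) ^ ((1 : ℝ) / 12) * (60 * q)) = 60 * q := by
          field_simp
        have h5 : (1 + 1 / 12 * ((5 * q)⁻¹ - 1)) * ((5 * q) ^ ((1 : ℝ) / 12) * (60 * q)) =
            (55 * q + 1) * (5 * q) ^ ((1 : ℝ) / 12) := by
          field_simp; ring
        linarith
      have h2 : (1 + (α ^ 4 - 1) * h) * (55 * q + 1) ≤ α * (60 * q) := by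
        have e1 : 1 + (α ^ 4 - 1) * h ≤ 1 + 0.081 * q := by nlinarith
        have e2 := mul_le_mul_of_nonneg_right e1 (by linarith : 0 ≤ 55 * q + 1)
        have e3 := mul_le_mul_of_nonneg_right lt_α.le (by linarith : 0 ≤ 60 * q)
        nlinarith
      have h3 := h2.trans (mul_le_mul_of_nonneg_left h1 ha.le)
      refine le_of_mul_le_mul_right (h3.trans_eq ?_) (by linarith : 0 < 55 * q + 1)
      ring
  have e : α ^ 2 * h + (α ^ 2)⁻¹ * (1 - h) = (α ^ 2)⁻¹ * (1 + (α ^ 4 - 1) * h) := by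
    field_simp; ring
  have e' : α⁻¹ * load q = (α ^ 2)⁻¹ * (α * load q) := by field_simp
  rw [e, e']
  exact mul_le_mul_of_nonneg_left key (by positivity)

/-- A linear bound for the next load `q'` in terms of the weight `Y` of the neighbours that hear
nothing, when the current load is `q` and a neighbour beeps with probability `h`. -/
theorem exists_load_bound {q h : ℝ} (hq : 0 ≤ q) (hh : q ≤ (1 + q) * h) (hhq : h ≤ q)
    (h1 : h ≤ 1) : ∃ k c : ℝ, 0 ≤ k ∧ 0 ≤ c ∧ c * q ≤ k * h ∧
      (∀ Y q', 0 ≤ Y → Y ≤ q → q' ≤ q / 2 + 3 / 2 * Y → load q' ≤ k + c * Y) ∧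
      k * (α ^ 2 * h + (α ^ 2)⁻¹ * (1 - h)) ≤ α⁻¹ * load q := by
  have ha := α_pos
  rcases le_or_gt q (1 / 10) with hq1 | hq1
  -- Even doubled, q stays at most 1/5, where the load is 1.
  · refine ⟨1, 0, zero_le_one, le_rfl, by nlinarith, fun Y q' hY hYq hq' => ?_, ?_⟩
    · rw [load, max_eq_right (by linarith), Real.one_rpow]; simp
    · rw [one_mul]
      exact final_bound_small (by linarith) hhq
  have hq0 : 0 < q := by linarith
  rcases le_or_gt q (2 / 5) with hq2 | hq2
  -- The bound on 5q' runs from 5q/2 ≤ 1 at Y = 0 to 10q at Y = q, so the chord from 1 to 10q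
  -- dominates max(5q', 1); Bernoulli then divides its slope by 12.
  · refine ⟨1, (10 * q - 1) / (12 * q), zero_le_one,
      div_nonneg (by linarith) (by linarith), ?_, fun Y q' hY hYq hq' => ?_, ?_⟩
    · have e : (10 * q - 1) / (12 * q) * q = (10 * q - 1) / 12 := by field_simp
      rw [e, one_mul, div_le_iff₀ (by norm_num)]
      refine le_of_mul_le_mul_left ?_ (by linarith : 0 < 1 + q)
      nlinarith
    · have hX0 : 0 ≤ Y / q := div_nonneg hY hq
      have hX1 : Y / q ≤ 1 := (div_le_one hq0).2 hYq
      have hYX : Y = q * (Y / q) := by field_simp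
      have hs : 0 ≤ Y / q * (10 * q - 1) := mul_nonneg hX0 (by linarith)
      have hm : max (5 * q') 1 ≤ 1 + Y / q * (10 * q - 1) := by
        refine max_le ?_ (by linarith)
        have : 5 * q' ≤ 5 * (q / 2 + 3 / 2 * (q * (Y / q))) := by rw [← hYX]; linarith
        nlinarith [mul_nonneg (sub_nonneg.2 hX1) (sub_nonneg.2 hq2)]
      refine (Real.rpow_le_rpow (le_max_of_le_right zero_le_one) hm (by norm_num)).trans
        ((rpow_twelfth_le (by linarith)).trans_eq ?_)
      field_simp
    · rw [one_mul]
      exact final_bound_small hq2 hhq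
  · have hk : 0 < (5 * q / 2) ^ ((1 : ℝ) / 12) := Real.rpow_pos_of_pos (by linarith) _
    have hh4 : 1 / 4 ≤ h := by nlinarith
    -- Here `k` is the load at q/2, that is α⁻³ times the current one, and `c` is Bernoulli's slope
    -- for 1 + 3Y/q. The condition on `c` becomes h ≥ 1/4, which follows from h ≥ q/(1 + q).
    refine ⟨(5 * q / 2) ^ ((1 : ℝ) / 12), (5 * q / 2) ^ ((1 : ℝ) / 12) / (4 * q), hk.le,
      by positivity, ?_, fun Y q' hY hYq hq' => ?_, ?_⟩
    · have e : (5 * q / 2) ^ ((1 : ℝ) / 12) / (4 * q) * q =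
          (5 * q / 2) ^ ((1 : ℝ) / 12) * (1 / 4) := by field_simp
      rw [e]
      exact mul_le_mul_of_nonneg_left hh4 hk.le
    · have hX0 : 0 ≤ 3 * Y / q := div_nonneg (by linarith) hq
      have e : 5 * q / 2 * (1 + 3 * Y / q) = 5 * (q / 2 + 3 / 2 * Y) := by field_simp
      have hm : max (5 * q') 1 ≤ 5 * q / 2 * (1 + 3 * Y / q) := by
        rw [e]
        exact max_le (by linarith) (by linarith)
      refine (Real.rpow_le_rpow (le_max_of_le_right zero_le_one) hm (by norm_num)).trans ?_
      rw [Real.mul_rpow (by linarith) (by linarith)]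
      refine (mul_le_mul_of_nonneg_left (rpow_twelfth_le (by linarith)) hk.le).trans_eq ?_
      field_simp; ring
    · have e : load q = α ^ 3 * (5 * q / 2) ^ ((1 : ℝ) / 12) := by
        rw [load, max_eq_left (by linarith)]
        have e1 : α ^ 3 = (2 : ℝ) ^ ((1 : ℝ) / 12) := by
          rw [α, ← Real.rpow_natCast, ← Real.rpow_mul two_pos.le]; norm_num
        rw [e1, ← Real.mul_rpow two_pos.le (by linarith)]
        congr 1; ring
      rw [e]
      have e2 : α⁻¹ * (α ^ 3 * (5 * q / 2) ^ ((1 : ℝ) / 12)) =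
          (5 * q / 2) ^ ((1 : ℝ) / 12) * α ^ 2 := by field_simp
      rw [e2]
      exact mul_le_mul_of_nonneg_left (halving_rate_le h1) hk.le

end Growth

/-! ### One phase: expected decrease of the potential. -/

section Phase

variable {V : Type*}

/-- The contribution `α ^ (-2 log₂ x)` of `p = x` to `α ^ t₀`. -/
noncomputable def boost (x : ℝ) : ℝ := α ^ (-2 * Real.logb 2 x)

theorem boost_pos (x : ℝ) : 0 < boost x := Real.rpow_pos_of_pos α_pos _

theorem boost_two_mul {x : ℝ} (hx : 0 < x) : boost (2 * x) = (α ^ 2)⁻¹ * boost x := by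
  have h : -2 * Real.logb 2 (2 * x) = -(2 : ℕ) + -2 * Real.logb 2 x := by
    rw [Real.logb_mul two_ne_zero hx.ne', Real.logb_self_eq_one one_lt_two]; push_cast; ring
  rw [boost, h, Real.rpow_add α_pos, Real.rpow_neg α_pos.le, Real.rpow_natCast, boost]

theorem boost_half {x : ℝ} (hx : 0 < x) : boost (x / 2) = α ^ 2 * boost x := by
  have h := boost_two_mul (half_pos hx)
  have ha := α_pos
  rw [mul_div_cancel₀ x two_ne_zero] at h
  rw [h]
  field_simp

theorem α_rpow_t₀ [Fintype V] (G : SimpleGraph V) (C : Config V) (v : V) :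
    α ^ t₀ G C v = load (C.q G v) * boost (C.p v) := by
  rw [t₀, sub_eq_add_neg, Real.rpow_add α_pos, α_rpow_l, boost, neg_mul]

namespace Config

variable (G : SimpleGraph V) (C : Config V)

theorem p_pos (v : V) : 0 < (C.p v : ℝ) := by
  obtain ⟨k, hk⟩ := C.p_dyadic v
  rw [hk]; positivity

theorem p_eq_half_or_le_quarter (v : V) : (C.p v : ℝ) = 1 / 2 ∨ 2 * (C.p v : ℝ) ≤ 1 / 2 := by
  obtain ⟨k, hk⟩ := C.p_dyadic v
  rw [hk]
  rcases k with _ | k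
  · left; simp
  · right
    push_cast
    have : ((1 : ℝ) / 2) ^ k ≤ 1 := pow_le_one₀ (by norm_num) (by norm_num)
    rw [pow_succ, pow_succ]; linarith

/-- The probability `beepProb` as a real number. -/
noncomputable def rate (u : V) : ℝ := C.beepProb u

theorem rate_nonneg (u : V) : 0 ≤ C.rate u := NNReal.coe_nonneg _

theorem rate_le_one (u : V) : C.rate u ≤ 1 := by
  exact_mod_cast C.beepProb_le_one u

theorem rate_of_active {u : V} (h : C.IsActive u) : C.rate u = C.p u := by
  rw [rate, beepProb, if_pos h]

theorem rate_of_not_active {u : V} (h : ¬ C.IsActive u) : C.rate u = 0 := by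
  rw [rate, beepProb, if_neg h]; rfl

variable {C} in
theorem isActive_of_next {B : Finset V} {v : V} (h : (C.next G B).IsActive v) : C.IsActive v := by
  by_contra hv
  have h' : C.nextStatus G B v = Status.active := h
  rw [nextStatus, if_neg hv] at h'
  exact hv h'

variable {C} in
theorem not_exclusive_of_next_isActive {B : Finset V} {v : V} (h : (C.next G B).IsActive v) :
    ¬ BeepsExclusively G B v ∧ ¬ ∃ u, G.Adj v u ∧ BeepsExclusively G B u := by
  have hv := isActive_of_next G h
  have h' : C.nextStatus G B v = Status.active := h
  rw [nextStatus, if_pos hv] at h'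
  split_ifs at h' with h1 h2
  exact ⟨h1, h2⟩

theorem next_p_of_hears {B : Finset V} {v : V} (h : Hears G B v) :
    ((C.next G B).p v : ℝ) = C.p v / 2 := by
  simp [next, nextP, h]

theorem next_p_of_not_hears {B : Finset V} {v : V} (h : ¬ Hears G B v) :
    ((C.next G B).p v : ℝ) = min (2 * (C.p v : ℝ)) (1 / 2) := by
  simp [next, nextP, h]

open Classical in
theorem next_rate_le (B : Finset V) (u : V) :
    (C.next G B).rate u ≤ C.rate u / 2 + 3 / 2 * if Hears G B u then 0 else C.rate u := by
  by_cases ha : (C.next G B).IsActive u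
  · rw [rate_of_active _ ha, rate_of_active _ (isActive_of_next G ha)]
    split_ifs with h
    · rw [next_p_of_hears G C h]; linarith
    · rw [next_p_of_not_hears G C h]
      exact (min_le_left _ _).trans (by linarith)
  · rw [rate_of_not_active _ ha]
    have := C.rate_nonneg u
    split_ifs <;> linarith

variable [Fintype V]

theorem coe_q (v : V) : (C.q G v : ℝ) = ∑ u ∈ nbrs G v, C.rate u := by
  rw [q, NNReal.coe_sum]; rfl

open Classical in
/-- Total beeping probability of the neighbours of `v` that hear no beep. -/
noncomputable def quiet (v : V) (B : Finset V) : ℝ :=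
  ∑ u ∈ nbrs G v, if Hears G B u then 0 else C.rate u

theorem quiet_nonneg (v : V) (B : Finset V) : 0 ≤ C.quiet G v B :=
  Finset.sum_nonneg fun u _ => by split_ifs; exacts [le_rfl, C.rate_nonneg u]

theorem quiet_le_q (v : V) (B : Finset V) : C.quiet G v B ≤ C.q G v := by
  rw [coe_q]
  exact Finset.sum_le_sum fun u _ => by split_ifs; exacts [C.rate_nonneg u, le_rfl]

theorem next_q_le (v : V) (B : Finset V) :
    ((C.next G B).q G v : ℝ) ≤ C.q G v / 2 + 3 / 2 * C.quiet G v B := by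
  rw [coe_q, coe_q, quiet, Finset.sum_div, Finset.mul_sum, ← Finset.sum_add_distrib]
  exact Finset.sum_le_sum fun u _ => C.next_rate_le G B u

theorem sum_weight_mul_quiet (v : V) :
    ∑ B, weight C.rate B * C.quiet G v B =
      ∑ u ∈ nbrs G v, C.rate u * silent C.rate (nbrs G u) := by
  simp only [quiet, Finset.mul_sum]
  rw [Finset.sum_comm]
  refine Finset.sum_congr rfl fun u _ => ?_
  rw [← prob_disjoint, prob, Finset.mul_sum]
  refine Finset.sum_congr rfl fun B _ => ?_
  rw [← not_hears_iff]
  by_cases h : Hears G B u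
  · simp [h]
  · simp [h, mul_comm]

open Classical in
/-- `α ^ t₀` while `v` is active, and `0` afterwards. -/
noncomputable def potential (v : V) : ℝ := if C.IsActive v then α ^ t₀ G C v else 0

theorem potential_nonneg (v : V) : 0 ≤ C.potential G v := by
  unfold potential
  split_ifs
  exacts [(Real.rpow_pos_of_pos α_pos _).le, le_rfl]

variable {C}

/-- The phases in which `v` hears nothing and stays active, and the factor `r` by which
`boost` then changes. -/
theorem exists_quiet_event {v : V} (hv : C.IsActive v) :
    ∃ (r : ℝ) (F : Finset V → Prop), 0 ≤ r ∧ r ≤ α ^ 2 ∧ (∀ B, F B → ¬ Hears G B v) ∧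
      r * prob C.rate F ≤ (α ^ 2)⁻¹ * silent C.rate (nbrs G v) ∧
      ∀ B, (C.next G B).IsActive v → ¬ Hears G B v →
        F B ∧ boost ((C.next G B).p v) = r * boost (C.p v) := by
  have ha := α_pos
  have h1 : 1 ≤ α ^ 2 := one_le_pow₀ (by linarith [lt_α])
  rcases C.p_eq_half_or_le_quarter v with hp | hp
  -- At the cap p cannot double, but `v` survives silence only by not beeping; that factor 1/2 is
  -- below α⁻².
  · refine ⟨1, fun B => v ∉ B ∧ ¬ Hears G B v, zero_le_one, h1, fun B hB => hB.2, ?_,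
      fun B hB hh => ⟨⟨fun hvB => (not_exclusive_of_next_isActive G hB).1 ⟨hvB, hh⟩, hh⟩, ?_⟩⟩
    · classical
      have hnv : v ∉ nbrs G v := by simp [mem_nbrs]
      have e : (fun B => v ∉ B ∧ ¬ Hears G B v) = fun B => Disjoint (insert v (nbrs G v)) B := by
        funext B
        rw [Finset.disjoint_insert_left, not_hears_iff]
      rw [e, prob_disjoint, silent_insert hnv, rate_of_active _ hv, hp, one_mul]
      refine mul_le_mul_of_nonneg_right ?_ (silent_nonneg C.rate_le_one _)
      rw [← one_div, le_div_iff₀ (by positivity)]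
      nlinarith [α_lt]
    · rw [next_p_of_not_hears G C hh, hp, one_mul, min_eq_right (by norm_num)]
  · refine ⟨(α ^ 2)⁻¹, fun B => ¬ Hears G B v, by positivity,
      (inv_le_one_of_one_le₀ h1).trans h1, fun B hB => hB, ?_, fun B hB hh => ⟨hh, ?_⟩⟩
    · simp only [not_hears_iff, prob_disjoint, le_refl]
    · rw [next_p_of_not_hears G C hh, min_eq_left hp, boost_two_mul (C.p_pos v)]

/-- Elimination removes α² k P(D) from the expected change of boost, and this pays for the term α² c
E[Y] from load growth. What remains is the last inequality of `exists_load_bound`, with h = 1 - s.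
-/
theorem sum_weight_potential_next_le_of_isActive {v : V} (hv : C.IsActive v) :
    ∑ B, weight C.rate B * (C.next G B).potential G v ≤ α⁻¹ * C.potential G v := by
  classical
  have h0 := C.rate_nonneg
  have hb := C.rate_le_one
  have ha := α_pos
  obtain ⟨r, F, hr0, hr1, hF, hFp, hFn⟩ := exists_quiet_event G hv
  set s := silent C.rate (nbrs G v) with hs
  set q : ℝ := ((C.q G v : ℝ≥0) : ℝ) with hq
  have hq' := C.coe_q G v
  rw [← hq] at hq'
  have hs0 : 0 ≤ s := silent_nonneg hb _
  have hs1 : 1 - q ≤ s := by rw [hq']; exact one_sub_sum_le_silent h0 hb _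
  have hs2 : s * (1 + q) ≤ 1 := by rw [hq']; exact silent_mul_le_one h0 hb _
  have hq0 : 0 ≤ q := NNReal.coe_nonneg _
  obtain ⟨k, c, hk, hc, hcq, hload, hfin⟩ :=
    exists_load_bound (h := 1 - s) hq0 (by linarith) (by linarith) (by linarith)
  set D : Finset V → Prop := fun B => ∃ u, G.Adj v u ∧ BeepsExclusively G B u with hD
  set M := ∑ u ∈ nbrs G v, C.rate u * silent C.rate (nbrs G u) with hM
  have hexcl : (1 - s) * M ≤ q * prob C.rate D := by
    rw [hq']; exact exclusive_bound G h0 hb v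
  have hM0 : 0 ≤ M := Finset.sum_nonneg fun u _ => mul_nonneg (h0 u) (silent_nonneg hb _)
  have hD0 : 0 ≤ prob C.rate D := Finset.sum_nonneg fun B _ => by
    split_ifs; exacts [weight_nonneg h0 hb B, le_rfl]
  have hMq : M ≤ q := by
    rw [hq']
    exact Finset.sum_le_sum fun u _ => mul_le_of_le_one_right (h0 u) (silent_le_one h0 hb _)
  have hcM : c * M ≤ k * prob C.rate D := by
    rcases hq0.eq_or_lt with hq0 | hq0
    · have : M = 0 := by linarith
      rw [this, mul_zero]
      exact mul_nonneg hk hD0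
    · refine le_of_mul_le_mul_left ?_ hq0
      have e1 := mul_le_mul_of_nonneg_right hcq hM0
      have e2 := mul_le_mul_of_nonneg_left hexcl hk
      linarith
  have hDH : ∀ B, D B → Hears G B v := fun B ⟨u, hu, hB⟩ => ⟨u, hB.1, hu⟩
  have hHprob : prob C.rate (fun B => Hears G B v ∧ ¬ D B) = 1 - s - prob C.rate D := by
    have e1 := prob_add (b := C.rate) (H := fun _ => True) (E := fun B => Hears G B v)
      (F := fun B => Disjoint (nbrs G v) B)
      (fun B => by rw [← not_hears_iff]; tauto) (fun B hB => by rw [← not_hears_iff]; tauto)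
    have e2 := prob_add (b := C.rate) (H := fun B => Hears G B v)
      (E := fun B => Hears G B v ∧ ¬ D B) (F := D)
      (fun B => ⟨fun h => or_iff_not_imp_right.2 fun h' => ⟨h, h'⟩, fun h => h.elim And.left (hDH B)⟩)
      (fun B hB => hB.2)
    have e3 : prob C.rate (fun _ => True) = 1 := by simp [prob, sum_weight]
    rw [prob_disjoint] at e1
    linarith
  -- ρ bounds the factor on boost, counting 0 when a neighbour's exclusive beep eliminates `v`.
  set ρ : Finset V → ℝ := fun B =>
    α ^ 2 * (if Hears G B v ∧ ¬ D B then 1 else 0) + r * (if F B then 1 else 0) with hρ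
  have hρ0 : ∀ B, 0 ≤ ρ B := fun B => by
    simp only [hρ]
    split_ifs <;> nlinarith
  have hρ1 : ∀ B, ρ B ≤ α ^ 2 := fun B => by
    simp only [hρ]
    by_cases h : F B
    · simp [h, hF B h, hr1]
    · rw [if_neg h]
      split_ifs <;> nlinarith
  have hstep : ∀ B, (C.next G B).potential G v ≤
      boost (C.p v) * (ρ B * (k + c * C.quiet G v B)) := fun B => by
    have hY := C.quiet_nonneg G v B
    have hlin : 0 ≤ k + c * C.quiet G v B := add_nonneg hk (mul_nonneg hc hY)
    unfold potential
    split_ifs with hact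
    · have hnD := (not_exclusive_of_next_isActive G hact).2
      have hbo : boost ((C.next G B).p v) = ρ B * boost (C.p v) := by
        by_cases hh : Hears G B v
        · have hnF : ¬ F B := fun h => hF B h hh
          rw [next_p_of_hears G C hh, boost_half (C.p_pos v)]
          simp only [hρ]
          rw [if_pos ⟨hh, hnD⟩, if_neg hnF]; ring
        · obtain ⟨hFB, e⟩ := hFn B hact hh
          rw [e]
          simp only [hρ]
          rw [if_neg (fun h => hh h.1), if_pos hFB]; ring
      rw [α_rpow_t₀, hbo]
      have := mul_le_mul_of_nonneg_right
        (hload _ _ hY (C.quiet_le_q G v B) (C.next_q_le G v B))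
        (mul_nonneg (hρ0 B) (boost_pos (C.p v)).le)
      linarith
    · exact mul_nonneg (boost_pos _).le (mul_nonneg (hρ0 B) hlin)
  have hρsum : ∑ B, weight C.rate B * ρ B ≤
      α ^ 2 * (1 - s - prob C.rate D) + (α ^ 2)⁻¹ * s := by
    have e : ∑ B, weight C.rate B * ρ B =
        α ^ 2 * prob C.rate (fun B => Hears G B v ∧ ¬ D B) + r * prob C.rate F := by
      simp only [prob, Finset.mul_sum]
      rw [← Finset.sum_add_distrib]
      refine Finset.sum_congr rfl fun B _ => ?_
      simp only [hρ]
      split_ifs <;> ring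
    rw [e, hHprob]
    linarith
  have hsum : ∑ B, weight C.rate B * (ρ B * (k + c * C.quiet G v B)) ≤ α⁻¹ * load q := by
    -- Only in the Y term is ρ replaced by its maximum α², so the dependence between ρ and Y plays
    -- no role.
    have e : ∀ B, weight C.rate B * (ρ B * (k + c * C.quiet G v B)) ≤
        k * (weight C.rate B * ρ B) + c * α ^ 2 * (weight C.rate B * C.quiet G v B) := fun B => by
      have := mul_le_mul_of_nonneg_left (hρ1 B) (mul_nonneg hc
        (mul_nonneg (weight_nonneg h0 hb B) (C.quiet_nonneg G v B)))
      linarith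
    refine (Finset.sum_le_sum fun B _ => e B).trans ?_
    rw [Finset.sum_add_distrib, ← Finset.mul_sum, ← Finset.mul_sum, sum_weight_mul_quiet, ← hM]
    have e1 := mul_le_mul_of_nonneg_left hρsum hk
    have e2 := mul_le_mul_of_nonneg_left hcM (sq_nonneg α)
    rw [sub_sub_cancel] at hfin
    linarith
  calc ∑ B, weight C.rate B * (C.next G B).potential G v
      ≤ ∑ B, weight C.rate B * (boost (C.p v) * (ρ B * (k + c * C.quiet G v B))) :=
        Finset.sum_le_sum fun B _ =>
          mul_le_mul_of_nonneg_left (hstep B) (weight_nonneg h0 hb B)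
    _ = boost (C.p v) * ∑ B, weight C.rate B * (ρ B * (k + c * C.quiet G v B)) := by
        rw [Finset.mul_sum]
        exact Finset.sum_congr rfl fun B _ => by ring
    _ ≤ boost (C.p v) * (α⁻¹ * load q) := mul_le_mul_of_nonneg_left hsum (boost_pos _).le
    _ = α⁻¹ * C.potential G v := by
        rw [potential, if_pos hv, α_rpow_t₀]; ring

theorem sum_weight_potential_next_le (C : Config V) (v : V) :
    ∑ B, weight C.rate B * (C.next G B).potential G v ≤ α⁻¹ * C.potential G v := by
  by_cases hv : C.IsActive v
  · exact sum_weight_potential_next_le_of_isActive G hv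
  · refine (Finset.sum_nonpos fun B _ => ?_).trans
      (mul_nonneg (inv_pos.2 α_pos).le (C.potential_nonneg G v))
    rw [potential, if_neg fun h => hv (isActive_of_next G h), mul_zero]

/-! ### From one phase to `t` phases. -/

theorem beepLaw_apply (C : Config V) (B : Finset V) :
    C.beepLaw B = ENNReal.ofReal (weight C.rate B) := by
  rw [beepLaw, PMF.ofFintype_apply, weight, ENNReal.ofReal_prod_of_nonneg]
  · refine Finset.prod_congr rfl fun v _ => ?_
    split_ifs
    · simp [rate]
    · rw [ENNReal.ofReal_sub _ (C.rate_nonneg v)]; simp [rate]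
  · intro v _
    split_ifs
    · exact C.rate_nonneg v
    · exact sub_nonneg.2 (C.rate_le_one v)

theorem probActive_succ (C : Config V) (v : V) (t : ℕ) :
    C.probActive G v (t + 1) =
      ∑ B, ENNReal.ofReal (weight C.rate B) * (C.next G B).probActive G v t := by
  rw [probActive, run, phase, PMF.bind_map, PMF.toOuterMeasure_bind_apply, tsum_fintype]
  simp only [beepLaw_apply]
  rfl

theorem one_le_α_rpow_t₀ (C : Config V) (v : V) : 1 ≤ α ^ t₀ G C v := by
  refine Real.one_le_rpow (by linarith [lt_α]) ?_
  have h1 : 0 ≤ l (C.q G v) := Real.logb_nonneg one_lt_two (by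
    linarith [le_max_right (C.q G v : ℝ) (1 / 5)])
  have h2 : Real.logb 2 (C.p v) ≤ 0 := by
    refine Real.logb_nonpos one_lt_two (NNReal.coe_nonneg _) ?_
    rcases C.p_eq_half_or_le_quarter v with h | h <;> linarith
  unfold t₀
  linarith

theorem probActive_le_potential (C : Config V) (v : V) (t : ℕ) :
    C.probActive G v t ≤ ENNReal.ofReal ((α⁻¹) ^ t * C.potential G v) := by
  -- The first phase is split off, so the induction hypothesis is needed at every successor
  -- configuration.
  induction t generalizing C with
  | zero =>
    rw [probActive, run, PMF.toOuterMeasure_pure_apply, pow_zero, one_mul, potential]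
    by_cases h : C.IsActive v
    · simpa [h] using one_le_α_rpow_t₀ G C v
    · simp [h]
  | succ t ih =>
    have h0 := weight_nonneg C.rate_nonneg C.rate_le_one
    have hα := (inv_pos.2 α_pos).le
    rw [probActive_succ]
    calc ∑ B, ENNReal.ofReal (weight C.rate B) * (C.next G B).probActive G v t
        ≤ ∑ B, ENNReal.ofReal (weight C.rate B * ((α⁻¹) ^ t * (C.next G B).potential G v)) := by
          refine Finset.sum_le_sum fun B _ => ?_
          rw [ENNReal.ofReal_mul (h0 B)]
          exact mul_le_mul_right (ih _) _
      _ = ENNReal.ofReal (∑ B, weight C.rate B * ((α⁻¹) ^ t * (C.next G B).potential G v)) :=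
          (ENNReal.ofReal_sum_of_nonneg fun B _ => mul_nonneg (h0 B)
            (mul_nonneg (pow_nonneg hα t) (potential_nonneg G _ v))).symm
      _ = ENNReal.ofReal ((α⁻¹) ^ t * ∑ B, weight C.rate B * (C.next G B).potential G v) := by
          rw [Finset.mul_sum]
          exact congrArg _ (Finset.sum_congr rfl fun B _ => by ring)
      _ ≤ ENNReal.ofReal ((α⁻¹) ^ (t + 1) * C.potential G v) := by
          refine ENNReal.ofReal_le_ofReal ?_
          rw [pow_succ, mul_assoc]
          exact mul_le_mul_of_nonneg_left (sum_weight_potential_next_le G C v)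
            (pow_nonneg hα t)

end Config

end Phase

end BeepMIS

theorem mainTheorem2 {V : Type*} [Fintype V] (G : SimpleGraph V) (C : BeepMIS.Config V)
    (v : V) (t : ℕ) :
    C.probActive G v t ≤ ENNReal.ofReal (BeepMIS.α ^ (BeepMIS.t₀ G C v - (t : ℝ))) := by
  refine (BeepMIS.Config.probActive_le_potential G C v t).trans (ENNReal.ofReal_le_ofReal ?_)
  rw [Real.rpow_sub BeepMIS.α_pos, Real.rpow_natCast, div_eq_inv_mul, inv_pow]
  refine mul_le_mul_of_nonneg_left ?_ (inv_nonneg.2 (pow_nonneg BeepMIS.α_pos.le t))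
  unfold BeepMIS.Config.potential
  split_ifs
  exacts [le_rfl, (Real.rpow_pos_of_pos BeepMIS.α_pos _).le]
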